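/- Let $\Omega\subset\mathbb R^2$ be a compact convex set with non-empty interior. For $v\in\mathbb Z^2\setminus\{0\}$ put $\alpha_v=-\min_{z\in\Omega} v\cdot z$, and define the tropical series $F_\Omega\colon\Omega\to\mathbb R$ by $$F_\Omega(z)=\inf_{v\in\mathbb Z^2\setminus\{0\}}(\alpha_v+v\cdot z),\qquad \mathbf m_\Omega=\max_{\Omega}F_\Omega .$$ A boundary point of $\Omega$ is called a corner if at least two different supporting lines of $\Omega$ pass through it. A Delzant polygon is a compact convex polygon with non-empty interior all of whose sides have rational slopes and such that for any two adjacent sides the primitive lattice vectors in their directions form a basis of $\mathbb Z^2$. Theorem. If $\partial\Omega$ has no corners, then for every $\varepsilon$ with $0<\varepsilon<\mathbf m_\Omega$ the level set $F_\Omega^{-1}(\varepsilon)$ bounds a Delzant polygon: the set $\Omega_\varepsilon=\{z\in\Omega: F_\Omega(z)\ge\varepsilon\}$ is a Delzant polygon and $\partial\Omega_\varepsilon=F_\Omega^{-1}(\varepsilon)$. -/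

import Mathlib

namespace TropicalSeries

/-- The real plane with its linear structure and topology (no norm is used below). -/
abbrev Plane : Type := Fin 2 → ℝ

/-- The lattice `ℤ²`. -/
abbrev Lattice : Type := Fin 2 → ℤ

/-- The inclusion `ℤ² ⊂ ℝ²`. -/
def toPlane (v : Lattice) : Plane := fun i => (v i : ℝ)

/-- A compact convex domain in the plane: a compact convex set with interior points. -/
structure IsCompactConvexDomain (Ω : Set Plane) : Prop where
  isCompact : IsCompact Ω
  convex : Convex ℝ Ω
  interior_nonempty : (interior Ω).Nonempty

/-- `n` is an outer normal of a supporting line of `Ω` passing through the point `p` of `Ω`;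
the line is `{z | n ⬝ᵥ z = n ⬝ᵥ p}`. -/
def IsSupportingNormal (Ω : Set Plane) (p n : Plane) : Prop :=
  n ≠ 0 ∧ p ∈ Ω ∧ ∀ z ∈ Ω, n ⬝ᵥ z ≤ n ⬝ᵥ p

/-- `p` is a corner of `Ω`: two different supporting lines of `Ω` pass through `p`. -/
def IsCorner (Ω : Set Plane) (p : Plane) : Prop :=
  ∃ n n' : Plane, IsSupportingNormal Ω p n ∧ IsSupportingNormal Ω p n' ∧
    LinearIndependent ℝ ![n, n']

/-- The boundary of `Ω` has no corners. -/
def NoCorners (Ω : Set Plane) : Prop :=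
  ∀ p ∈ frontier Ω, ¬ IsCorner Ω p

/-- The coefficient `α_v = - min_{z ∈ Ω} v · z`. -/
noncomputable def coeff (Ω : Set Plane) (v : Lattice) : ℝ :=
  - sInf ((fun z : Plane => toPlane v ⬝ᵥ z) '' Ω)

/-- For a nonempty compact `Ω` the infimum in the definition of `coeff` is a minimum. -/
theorem isLeast_neg_coeff {Ω : Set Plane} (hc : IsCompact Ω) (hne : Ω.Nonempty) (v : Lattice) :
    IsLeast ((fun z : Plane => toPlane v ⬝ᵥ z) '' Ω) (- coeff Ω v) := by
  have hcont : Continuous (fun z : Plane => toPlane v ⬝ᵥ z) := by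
    unfold dotProduct
    fun_prop
  have h := (hc.image hcont).isLeast_sInf (hne.image _)
  simpa [coeff] using h

/-- The tropical series `F_Ω(z) = inf_v (α_v + v · z)` over the nonzero lattice vectors `v`.
It is considered at points `z` of `Ω` only. -/
noncomputable def series (Ω : Set Plane) (z : Plane) : ℝ :=
  ⨅ v : {v : Lattice // v ≠ 0}, (coeff Ω v.1 + toPlane v.1 ⬝ᵥ z)

/-- On a compact `Ω` the monomials of the series are nonnegative, so that the infimum in the
definition of `series` is that of a family bounded from below. -/
theorem monomial_nonneg {Ω : Set Plane} (hc : IsCompact Ω) {z : Plane} (hz : z ∈ Ω)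
    (v : Lattice) : 0 ≤ coeff Ω v + toPlane v ⬝ᵥ z := by
  have h := (isLeast_neg_coeff hc ⟨z, hz⟩ v).2 ⟨z, hz, rfl⟩
  simp only at h
  linarith

theorem bddBelow_monomials {Ω : Set Plane} (hc : IsCompact Ω) {z : Plane} (hz : z ∈ Ω) :
    BddBelow (Set.range fun v : {v : Lattice // v ≠ 0} => coeff Ω v.1 + toPlane v.1 ⬝ᵥ z) := by
  refine ⟨0, ?_⟩
  rintro _ ⟨v, rfl⟩
  exact monomial_nonneg hc hz v.1

/-- The maximal value `m_Ω` of `F_Ω` on `Ω`. -/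
noncomputable def maxValue (Ω : Set Plane) : ℝ := sSup (series Ω '' Ω)

/-- The values of the series on a compact `Ω` are bounded from above, so that the supremum in
the definition of `maxValue` is not a junk value. -/
theorem bddAbove_series {Ω : Set Plane} (hc : IsCompact Ω) : BddAbove (series Ω '' Ω) := by
  have hcont : Continuous (fun z : Plane => toPlane ![1, 0] ⬝ᵥ z) := by
    unfold dotProduct
    fun_prop
  obtain ⟨B, hB⟩ := (hc.image hcont).bddAbove
  refine ⟨coeff Ω ![1, 0] + B, ?_⟩
  rintro _ ⟨z, hz, rfl⟩
  have hv : (![1, 0] : Lattice) ≠ 0 := fun h => by simpa using congrFun h 0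
  have h1 : series Ω z ≤ coeff Ω ![1, 0] + toPlane ![1, 0] ⬝ᵥ z :=
    ciInf_le (bddBelow_monomials hc hz) ⟨![1, 0], hv⟩
  have h2 : toPlane ![1, 0] ⬝ᵥ z ≤ B := hB ⟨z, hz, rfl⟩
  linarith

/-- The level set `F_Ω⁻¹(ε)`. -/
def levelSet (Ω : Set Plane) (ε : ℝ) : Set Plane := {z ∈ Ω | series Ω z = ε}

/-- The superlevel set `Ω_ε = F_Ω⁻¹[ε, ∞)`. -/
def superlevelSet (Ω : Set Plane) (ε : ℝ) : Set Plane := {z ∈ Ω | ε ≤ series Ω z}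

/-- A convex polygon: a compact set with interior points that is the intersection of finitely
many closed half-planes. -/
def IsConvexPolygon (Δ : Set Plane) : Prop :=
  IsCompact Δ ∧ (interior Δ).Nonempty ∧
    ∃ H : Finset (Plane × ℝ), Δ = {z | ∀ h ∈ H, h.1 ⬝ᵥ z ≤ h.2}

/-- A side of a convex polygon `Δ`: a proper exposed face with more than one point. -/
def IsSide (Δ S : Set Plane) : Prop :=
  IsExposed ℝ Δ S ∧ S ≠ Δ ∧ S.Nontrivial

/-- A primitive lattice vector: its coordinates are coprime. -/
def IsPrimitive (u : Lattice) : Prop := IsCoprime (u 0) (u 1)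

/-- `u` is a primitive lattice vector in the direction of the side `S`. -/
def IsPrimitiveDirection (S : Set Plane) (u : Lattice) : Prop :=
  IsPrimitive u ∧ ∀ p ∈ S, ∀ q ∈ S, ∃ t : ℝ, q - p = t • toPlane u

/-- A `ℚ`-polygon: a convex polygon whose sides have rational slopes. -/
def IsQPolygon (Δ : Set Plane) : Prop :=
  IsConvexPolygon Δ ∧ ∀ S, IsSide Δ S → ∃ u : Lattice, IsPrimitiveDirection S u

/-- A Delzant polygon: a `ℚ`-polygon such that for any two adjacent sides, that is, distinct
sides with a common point, primitive vectors in their directions form a basis of `ℤ²`. -/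
def IsDelzant (Δ : Set Plane) : Prop :=
  IsQPolygon Δ ∧
    ∀ S T : Set Plane, IsSide Δ S → IsSide Δ T → S ≠ T → (S ∩ T).Nonempty →
      ∀ u w : Lattice, IsPrimitiveDirection S u → IsPrimitiveDirection T w →
        ∃ b : Module.Basis (Fin 2) ℤ Lattice, ⇑b = ![u, w]

end TropicalSeries

namespace TropicalSeries

open Set Metric

/-! Write F_v for `monomial Ω v`: it is nonnegative on Ω and vanishes at some point of Ω. At a
boundary point some F_v is arbitrarily small, because Dirichlet approximates the normal of a
supporting line by lattice vectors. So the compact set {F_Ω ≥ ε} lies in the interior of Ω, where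
F_v grows with |v|. Only finitely many F_v matter on it: it is a polygon
(`exists_finset_superlevelSet_eq`), and its boundary is where some F_v equals ε.

For the Delzant condition let F_v = F_w = ε at a vertex p, with d = det(v, w) > 0. As v is
primitive, some lattice vector u satisfies d u = m v + w with 0 ≤ m < d (`exists_lattice_point`).
Comparing p with a zero x of F_u gives d F_u(p) = (m + 1)ε - m F_v(x) - F_w(x). Since F_u(p) ≥ ε,
equality holds throughout: m = d - 1 and m F_v(x) = F_w(x) = 0. If d > 1, two independent monomials
vanish at x, which is then a corner. Hence d = 1 (`det_eq_one_of_pos`). Side directions are v and w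
rotated by a right angle, up to sign, so they form a basis. -/

/-- The monomial `α_v + v · z` of the series. -/
noncomputable def monomial (Ω : Set Plane) (v : Lattice) (z : Plane) : ℝ :=
  coeff Ω v + toPlane v ⬝ᵥ z

/-! ### Monomials and superlevel sets -/

theorem toPlane_dotProduct (v : Lattice) (z : Plane) :
    toPlane v ⬝ᵥ z = v 0 * z 0 + v 1 * z 1 := by
  simp [dotProduct, Fin.sum_univ_two, toPlane]

theorem monomial_eq (Ω : Set Plane) (v : Lattice) (z : Plane) :
    monomial Ω v z = coeff Ω v + (v 0 * z 0 + v 1 * z 1) := by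
  rw [monomial, toPlane_dotProduct]

theorem continuous_monomial (Ω : Set Plane) (v : Lattice) : Continuous (monomial Ω v) := by
  have h : monomial Ω v = fun z => coeff Ω v + (v 0 * z 0 + v 1 * z 1) :=
    funext (monomial_eq Ω v)
  rw [h]
  fun_prop

theorem exists_monomial_eq_zero {Ω : Set Plane} (hc : IsCompact Ω) (hne : Ω.Nonempty)
    (v : Lattice) : ∃ x ∈ Ω, monomial Ω v x = 0 := by
  obtain ⟨x, hx, h⟩ := (isLeast_neg_coeff hc hne v).1
  refine ⟨x, hx, ?_⟩
  simp only at h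
  rw [monomial, h]
  ring

theorem le_series_iff {Ω : Set Plane} (hc : IsCompact Ω) {z : Plane} (hz : z ∈ Ω) {r : ℝ} :
    r ≤ series Ω z ↔ ∀ v : Lattice, v ≠ 0 → r ≤ monomial Ω v z := by
  have : Nonempty {v : Lattice // v ≠ 0} := ⟨⟨![1, 0], fun h => by simpa using congrFun h 0⟩⟩
  exact (le_ciInf_iff (bddBelow_monomials hc hz)).trans Subtype.forall

theorem mem_superlevelSet_iff {Ω : Set Plane} (hc : IsCompact Ω) {z : Plane} {ε : ℝ} :
    z ∈ superlevelSet Ω ε ↔ z ∈ Ω ∧ ∀ v : Lattice, v ≠ 0 → ε ≤ monomial Ω v z :=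
  and_congr_right fun hz => le_series_iff hc hz

theorem isCompact_superlevelSet {Ω : Set Plane} (hc : IsCompact Ω) (ε : ℝ) :
    IsCompact (superlevelSet Ω ε) := by
  have h : superlevelSet Ω ε = Ω ∩ ⋂ (v : Lattice) (_ : v ≠ 0), {z | ε ≤ monomial Ω v z} := by
    ext z
    simp [mem_superlevelSet_iff hc]
  rw [h]
  exact hc.inter_right (isClosed_iInter fun v => isClosed_iInter fun _ =>
    isClosed_le continuous_const (continuous_monomial Ω v))

/-! ### Small values at the boundary -/

theorem dual_apply (l : StrongDual ℝ Plane) (z : Plane) :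
    l z = z 0 * l ![1, 0] + z 1 * l ![0, 1] := by
  have h : z = z 0 • ![(1 : ℝ), 0] + z 1 • ![(0 : ℝ), 1] := by
    ext i; fin_cases i <;> simp
  rw [← smul_eq_mul, ← smul_eq_mul, ← map_smul, ← map_smul, ← map_add, ← h]

/-- At a boundary point the series takes arbitrarily small values, by Dirichlet's approximation
of the normal of a supporting line. -/
theorem exists_monomial_lt_of_mem_frontier {Ω : Set Plane} (hΩ : IsCompactConvexDomain Ω)
    {p : Plane} (hp : p ∈ frontier Ω) {ε : ℝ} (hε : 0 < ε) :
    ∃ v : Lattice, v ≠ 0 ∧ monomial Ω v p < ε := by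
  have hcl := hΩ.isCompact.isClosed
  have hpΩ : p ∈ Ω := hcl.frontier_subset hp
  obtain ⟨l, hl⟩ := geometric_hahn_banach_open_point hΩ.convex.interior isOpen_interior hp.2
  have hle : ∀ z ∈ Ω, l z ≤ l p := by
    intro z hz
    have hz' : z ∈ closure (interior Ω) := by
      rw [hΩ.convex.closure_interior_eq_closure_of_nonempty_interior hΩ.interior_nonempty]
      exact subset_closure hz
    have hclosed : IsClosed {y : Plane | l y ≤ l p} :=
      isClosed_le l.continuous continuous_const
    exact closure_minimal (fun y hy => (hl y hy).le) hclosed hz'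
  set a := l ![1, 0]
  set b := l ![0, 1]
  have hlz : ∀ z : Plane, l z = z 0 * a + z 1 * b := dual_apply l
  have hne : ¬ (a = 0 ∧ b = 0) := by
    rintro ⟨h0, h1⟩
    obtain ⟨y, hy⟩ := hΩ.interior_nonempty
    have := hl y hy
    simp [hlz, h0, h1] at this
  obtain ⟨B, hB⟩ := hΩ.isCompact.isBounded.subset_closedBall (0 : Plane)
  have hcoord : ∀ z ∈ Ω, ∀ i, |z i| ≤ B := fun z hz i => by
    have h1 := hB hz
    rw [mem_closedBall_zero_iff] at h1
    exact (norm_le_pi_norm z i).trans h1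
  have hdiff : ∀ z ∈ Ω, ∀ i, |p i - z i| ≤ 2 * B := fun z hz i => by
    have h1 := hcoord z hz i
    have h2 := hcoord p hpΩ i
    have h3 := abs_sub (p i) (z i)
    linarith
  have hB0 : 0 ≤ B := (abs_nonneg _).trans (hcoord p hpΩ 0)
  obtain ⟨N, hN⟩ := exists_nat_gt (2 * B / ε)
  -- If v is -c l up to an error r in one coordinate, compare p with a zero x of F_v: since l is
  -- maximal at p, F_v(p) = v · (p - x) ≤ r (p i - x i), and N makes this less than ε.
  have key : ∀ v : Lattice, ∀ c r : ℝ, ∀ i : Fin 2, 0 ≤ c → |r| ≤ 1 / ((N + 1 : ℕ) + 1 : ℝ) →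
      (∀ z : Plane, v 0 * z 0 + v 1 * z 1 = - (c * l z) + r * z i) → monomial Ω v p < ε := by
    intro v c r i hc0 hr hv
    obtain ⟨x, hx, hx0⟩ := exists_monomial_eq_zero hΩ.isCompact ⟨p, hpΩ⟩ v
    rw [monomial_eq, hv] at hx0 ⊢
    have h1 : r * (p i - x i) ≤ 1 / ((N + 1 : ℕ) + 1 : ℝ) * (2 * B) :=
      (le_abs_self _).trans ((abs_mul _ _).le.trans
        (mul_le_mul hr (hdiff x hx i) (abs_nonneg _) (by positivity)))
    have h2 : 1 / ((N + 1 : ℕ) + 1 : ℝ) * (2 * B) < ε := by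
      rw [div_lt_iff₀ hε] at hN
      rw [one_div_mul_eq_div, div_lt_iff₀ (by positivity)]
      push_cast
      nlinarith
    have h3 := mul_le_mul_of_nonneg_left (hle x hx) hc0
    nlinarith
  by_cases hb0 : b = 0
  · have ha0 : a ≠ 0 := fun h => hne ⟨h, hb0⟩
    have hs : (SignType.sign a : ℝ) = a / |a| := by
      rw [eq_div_iff (abs_ne_zero.2 ha0), sign_mul_abs]
    refine ⟨![-(SignType.sign a : ℤ), 0], fun h => ?_, key _ (1 / |a|) 0 0 (by positivity)
      (by rw [abs_zero]; positivity) fun z => ?_⟩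
    · have := congrFun h 0
      rcases lt_or_gt_of_ne ha0 with h' | h' <;> simp [h'] at this
    · have : ((SignType.sign a : ℤ) : ℝ) = (SignType.sign a : ℝ) := by
        rcases lt_or_gt_of_ne ha0 with h' | h' <;> simp [h']
      simp [hlz, hb0, this, hs]
      ring
  -- Scaling the normal (a, b) by k / |b| makes its second coordinate ±k, an integer, so only k a /
  -- |b| has to be approximated.
  · obtain ⟨j, k, hk, -, hjk⟩ := Real.exists_int_int_abs_mul_sub_le (a / |b|)
      (Nat.succ_pos N)
    have hs : (SignType.sign b : ℝ) = b / |b| := by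
      rw [eq_div_iff (abs_ne_zero.2 hb0), sign_mul_abs]
    refine ⟨![-j, -(SignType.sign b : ℤ) * k], fun h => ?_,
      key _ (k / |b|) (k * (a / |b|) - j) 0 (by positivity) hjk fun z => ?_⟩
    · have := congrFun h 1
      rcases lt_or_gt_of_ne hb0 with h' | h' <;> simp [h', hk.ne'] at this
    · simp only [Matrix.cons_val_zero, Matrix.cons_val_one, hlz]
      push_cast
      rw [hs]
      ring

theorem superlevelSet_subset_interior {Ω : Set Plane} (hΩ : IsCompactConvexDomain Ω)
    {ε : ℝ} (hε : 0 < ε) : superlevelSet Ω ε ⊆ interior Ω := by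
  intro z hz
  by_contra hzi
  obtain ⟨v, hv, hlt⟩ := exists_monomial_lt_of_mem_frontier hΩ ⟨subset_closure hz.1, hzi⟩ hε
  exact absurd (((mem_superlevelSet_iff hΩ.isCompact).1 hz).2 v hv) hlt.not_ge

/-! ### Finiteness of the relevant monomials -/

/-- Moving z by δ against the sign of v i along the i-th axis stays in Ω and lowers F_v by δ |v i|,
yet F_v remains nonnegative. -/
theorem mul_abs_le_monomial {Ω : Set Plane} (hc : IsCompact Ω) {z : Plane} {δ : ℝ} (hδ : 0 ≤ δ)
    (hz : closedBall z δ ⊆ Ω) (v : Lattice) (i : Fin 2) : δ * |(v i : ℝ)| ≤ monomial Ω v z := by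
  set s : ℝ := ((SignType.sign (v i : ℝ) : SignType) : ℝ) with hs
  have hs1 : |s| ≤ 1 := by
    rcases lt_trichotomy (v i : ℝ) 0 with h | h | h <;> simp [hs, h]
  have hsv : (v i : ℝ) * s = |(v i : ℝ)| := by
    rw [mul_comm, hs, sign_mul_self]
  have hmem : z - Pi.single i (δ * s) ∈ Ω := by
    apply hz
    rw [mem_closedBall, dist_eq_norm, sub_sub_cancel_left, norm_neg, Pi.norm_single,
      Real.norm_eq_abs, abs_mul, abs_of_nonneg hδ]
    nlinarith
  have h : 0 ≤ monomial Ω v (z - Pi.single i (δ * s)) := monomial_nonneg hc hmem v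
  rw [monomial, dotProduct_sub, dotProduct_single] at h
  rw [monomial, ← hsv]
  have : toPlane v i = v i := rfl
  rw [this] at h
  linarith

/-- Only finitely many monomials matter on a superlevel set. -/
theorem exists_finset_superlevelSet_eq {Ω : Set Plane} (hΩ : IsCompactConvexDomain Ω)
    {ε : ℝ} (hε : 0 < ε) (hne : (superlevelSet Ω ε).Nonempty) :
    ∃ V : Finset Lattice, (∀ v ∈ V, v ≠ 0) ∧
      superlevelSet Ω ε = {z | ∀ v ∈ V, ε ≤ monomial Ω v z} ∧
      ∀ v ∉ V, v ≠ 0 → ∀ z ∈ superlevelSet Ω ε, ε + 1 ≤ monomial Ω v z := by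
  have hc := hΩ.isCompact
  have hΔ := isCompact_superlevelSet hc ε
  obtain ⟨δ, hδ, hsub⟩ := hΔ.exists_cthickening_subset_open isOpen_interior
    (superlevelSet_subset_interior hΩ hε)
  obtain ⟨N, hN⟩ := exists_nat_gt ((ε + 1) / (δ / 2))
  have hfin : {v : Lattice | ∀ i, v i ∈ Icc (-(N : ℤ)) N}.Finite := by
    simpa [Set.pi] using Set.Finite.pi' (fun _ : Fin 2 => Set.finite_Icc (-(N : ℤ)) N)
  let V : Finset Lattice := hfin.toFinset.filter (· ≠ 0)
  have hlarge : ∀ v ∉ V, v ≠ 0 → ∀ z ∈ cthickening (δ / 2) (superlevelSet Ω ε),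
      ε + 1 ≤ monomial Ω v z := by
    intro v hv hv0 z hz
    have hball : closedBall z (δ / 2) ⊆ Ω := by
      refine Subset.trans ?_ (hsub.trans interior_subset)
      refine (closedBall_subset_cthickening hz _).trans
        ((cthickening_cthickening_subset (by positivity) (by positivity) _).trans ?_)
      rw [add_halves]
    have : ∃ i, v i ∉ Icc (-(N : ℤ)) N := by
      by_contra! h
      exact hv (by simp only [V, Finset.mem_filter, Set.Finite.mem_toFinset]; exact ⟨h, hv0⟩)
    obtain ⟨i, hi⟩ := this
    have hNi : (N : ℝ) ≤ |(v i : ℝ)| := by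
      have : (N : ℤ) ≤ |v i| := by
        rw [mem_Icc, ← abs_le] at hi
        exact (not_le.1 hi).le
      exact_mod_cast this
    refine le_trans ?_ (mul_abs_le_monomial hc (by positivity) hball v i)
    rw [div_lt_iff₀ (by positivity)] at hN
    nlinarith
  have hΔP : superlevelSet Ω ε ⊆ {z | ∀ v ∈ V, ε ≤ monomial Ω v z} := fun z hz v hv =>
    ((mem_superlevelSet_iff hc).1 hz).2 v (Finset.mem_filter.1 hv).2
  -- The finitely many inequalities do not by themselves force z ∈ Ω; near the superlevel set they
  -- suffice.
  have hPΔ : cthickening (δ / 2) (superlevelSet Ω ε) ∩ {z | ∀ v ∈ V, ε ≤ monomial Ω v z} ⊆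
      superlevelSet Ω ε := by
    rintro z ⟨hz, hzV⟩
    refine (mem_superlevelSet_iff hc).2 ⟨interior_subset (hsub
      (cthickening_mono (by linarith) _ hz)), fun v hv => ?_⟩
    by_cases h : v ∈ V
    · exact hzV v h
    · linarith [hlarge v h hv z hz]
  have hconv : Convex ℝ {z | ∀ v ∈ V, ε ≤ monomial Ω v z} := by
    intro x hx y hy a b ha hb hab v hv
    have h1 := mul_le_mul_of_nonneg_left (hx v hv) ha
    have h2 := mul_le_mul_of_nonneg_left (hy v hv) hb
    have h3 : monomial Ω v (a • x + b • y) = a * monomial Ω v x + b * monomial Ω v y := by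
      obtain rfl : b = 1 - a := by linarith
      simp only [monomial_eq, Pi.add_apply, Pi.smul_apply, smul_eq_mul]
      ring
    rw [h3]
    have : a * ε + b * ε = ε := by rw [← add_mul, hab, one_mul]
    linarith
  refine ⟨V, fun v hv => (Finset.mem_filter.1 hv).2, hΔP.antisymm ?_, fun v hv hv0 z hz =>
    hlarge v hv hv0 z (self_subset_cthickening _ hz)⟩
  have hthick : superlevelSet Ω ε ⊆ thickening (δ / 2) (superlevelSet Ω ε) :=
    self_subset_thickening (by positivity) _
  obtain ⟨y, hy⟩ := hne
  -- The polygon is connected and meets the closed neighbourhood only inside the open one, so it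
  -- cannot leave that neighbourhood.
  have := hconv.isPreconnected.subset_of_closure_inter_subset
    (isOpen_thickening (δ := δ / 2) (E := superlevelSet Ω ε)) ⟨y, hΔP hy, hthick hy⟩
    fun z hz => hthick (hPΔ ⟨closure_thickening_subset_cthickening _ _ hz.1, hz.2⟩)
  exact fun z hz => hPΔ ⟨thickening_subset_cthickening _ _ (this hz), hz⟩

/-! ### Interior and frontier of the superlevel set -/

/-- A point where a nonconstant monomial attains its minimum over a set is not interior. -/
theorem notMem_interior_of_isMin {Ω A : Set Plane} {v : Lattice} (hv : v ≠ 0) {z : Plane}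
    (hmin : ∀ y ∈ A, monomial Ω v z ≤ monomial Ω v y) : z ∉ interior A := by
  intro hz
  have hcont : Continuous fun t : ℝ => z - t • toPlane v := by fun_prop
  have hmem : ∀ᶠ t in nhds (0 : ℝ), z - t • toPlane v ∈ A :=
    hcont.continuousAt.eventually_mem (by simpa using mem_interior_iff_mem_nhds.1 hz)
  obtain ⟨t, ht, ht0⟩ := ((hmem.filter_mono nhdsWithin_le_nhds).and
    (self_mem_nhdsWithin (s := Ioi (0 : ℝ)))).exists
  have h := hmin _ ht
  simp only [monomial_eq, Pi.sub_apply, Pi.smul_apply, smul_eq_mul, toPlane] at h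
  have ht0 : 0 < t := ht0
  have h' : t * ((v 0 : ℝ) ^ 2 + (v 1 : ℝ) ^ 2) ≤ 0 := by nlinarith
  have h'' : (v 0 : ℝ) ^ 2 + (v 1 : ℝ) ^ 2 ≤ 0 := nonpos_of_mul_nonpos_right h' ht0
  apply hv
  have h0 : (v 0 : ℝ) = 0 := by nlinarith [sq_nonneg (v 0 : ℝ), sq_nonneg (v 1 : ℝ)]
  have h1 : (v 1 : ℝ) = 0 := by nlinarith [sq_nonneg (v 0 : ℝ), sq_nonneg (v 1 : ℝ)]
  ext i
  fin_cases i
  · exact_mod_cast h0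
  · exact_mod_cast h1

theorem mem_interior_superlevelSet_iff {Ω : Set Plane} (hΩ : IsCompactConvexDomain Ω)
    {ε : ℝ} (hε : 0 < ε) {z : Plane} (hz : z ∈ superlevelSet Ω ε) :
    z ∈ interior (superlevelSet Ω ε) ↔ ∀ v : Lattice, v ≠ 0 → monomial Ω v z ≠ ε := by
  have hmem := fun {y} => mem_superlevelSet_iff (z := y) (ε := ε) hΩ.isCompact
  constructor
  · rintro hzi v hv rfl
    exact notMem_interior_of_isMin hv (fun y hy => (hmem.1 hy).2 v hv) hzi
  · intro h
    obtain ⟨V, hV0, hV, -⟩ := exists_finset_superlevelSet_eq hΩ hε ⟨z, hz⟩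
    have hopen : IsOpen (⋂ v ∈ V, {y | ε < monomial Ω v y}) :=
      isOpen_biInter_finset fun v _ => isOpen_lt continuous_const (continuous_monomial Ω v)
    refine interior_maximal ?_ hopen ?_
    · intro y hy
      rw [hV]
      simp only [mem_iInter, mem_ofPred_eq] at hy ⊢
      exact fun v hv => (hy v hv).le
    · simp only [mem_iInter, mem_ofPred_eq]
      exact fun v hv => lt_of_le_of_ne ((hmem.1 hz).2 v (hV0 v hv)) (h v (hV0 v hv)).symm

/-- The infimum cannot equal ε without being attained: finitely many monomials compete, and the
others stay above ε + 1. -/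
theorem series_eq_iff_exists_monomial {Ω : Set Plane} (hΩ : IsCompactConvexDomain Ω)
    {ε : ℝ} (hε : 0 < ε) {z : Plane} (hz : z ∈ superlevelSet Ω ε) :
    series Ω z = ε ↔ ∃ v : Lattice, v ≠ 0 ∧ monomial Ω v z = ε := by
  have hc := hΩ.isCompact
  constructor
  · intro h
    by_contra! hne
    obtain ⟨V, hV0, -, hV⟩ := exists_finset_superlevelSet_eq hΩ hε ⟨z, hz⟩
    have hgt : ∀ v : Lattice, v ≠ 0 → ε < monomial Ω v z := fun v hv =>
      lt_of_le_of_ne (((mem_superlevelSet_iff hc).1 hz).2 v hv) (hne v hv).symm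
    obtain ⟨r, hr, hrV⟩ : ∃ r > ε, ∀ v ∈ V, r ≤ monomial Ω v z := by
      rcases V.eq_empty_or_nonempty with rfl | hVne
      · exact ⟨ε + 1, by linarith, by simp⟩
      · obtain ⟨v, hv, hmin⟩ := V.exists_min_image (fun v => monomial Ω v z) hVne
        exact ⟨_, hgt v (hV0 v hv), hmin⟩
    have : min r (ε + 1) ≤ series Ω z := (le_series_iff hc hz.1).2 fun v hv => by
      by_cases h : v ∈ V
      · exact (min_le_left _ _).trans (hrV v h)
      · exact (min_le_right _ _).trans (hV v h hv z hz)
    have h2 : ε < min r (ε + 1) := lt_min hr (by linarith)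
    linarith
  · rintro ⟨v, hv, h⟩
    exact le_antisymm (((le_series_iff hc hz.1).1 le_rfl v hv).trans_eq h) hz.2

theorem frontier_superlevelSet {Ω : Set Plane} (hΩ : IsCompactConvexDomain Ω)
    {ε : ℝ} (hε : 0 < ε) : frontier (superlevelSet Ω ε) = levelSet Ω ε := by
  rw [(isCompact_superlevelSet hΩ.isCompact ε).isClosed.frontier_eq]
  ext z
  constructor
  · rintro ⟨hz, hzi⟩
    refine ⟨hz.1, (series_eq_iff_exists_monomial hΩ hε hz).2 ?_⟩
    rw [mem_interior_superlevelSet_iff hΩ hε hz] at hzi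
    push Not at hzi
    exact hzi
  · rintro ⟨hz, h⟩
    have hzΔ : z ∈ superlevelSet Ω ε := ⟨hz, h.ge⟩
    obtain ⟨v, hv, hvz⟩ := (series_eq_iff_exists_monomial hΩ hε hzΔ).1 h
    exact ⟨hzΔ, fun hzi => (mem_interior_superlevelSet_iff hΩ hε hzΔ).1 hzi v hv hvz⟩

theorem exists_lt_series {Ω : Set Plane} {ε : ℝ} (hne : Ω.Nonempty) (hεm : ε < maxValue Ω) :
    ∃ z ∈ Ω, ε < series Ω z := by
  obtain ⟨_, ⟨z, hz, rfl⟩, h⟩ := exists_lt_of_lt_csSup (hne.image _) hεm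
  exact ⟨z, hz, h⟩

theorem isConvexPolygon_superlevelSet {Ω : Set Plane} (hΩ : IsCompactConvexDomain Ω)
    {ε : ℝ} (hε : 0 < ε) (hεm : ε < maxValue Ω) : IsConvexPolygon (superlevelSet Ω ε) := by
  obtain ⟨z, hz, hzε⟩ := exists_lt_series (hΩ.interior_nonempty.mono interior_subset) hεm
  have hzΔ : z ∈ superlevelSet Ω ε := ⟨hz, hzε.le⟩
  refine ⟨isCompact_superlevelSet hΩ.isCompact ε, ⟨z, ?_⟩, ?_⟩
  · exact (mem_interior_superlevelSet_iff hΩ hε hzΔ).2 fun v hv =>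
      (hzε.trans_le ((le_series_iff hΩ.isCompact hz).1 le_rfl v hv)).ne'
  · obtain ⟨V, -, hV, -⟩ := exists_finset_superlevelSet_eq hΩ hε ⟨z, hzΔ⟩
    refine ⟨V.image fun v => (-toPlane v, coeff Ω v - ε), ?_⟩
    rw [hV]
    ext y
    simp only [mem_ofPred_eq, Finset.forall_mem_image, neg_dotProduct, monomial]
    exact forall₂_congr fun v _ => ⟨fun h => by linarith, fun h => by linarith⟩

/-! ### Primitivity and determinants of active slopes -/

/-- The difference of the two sides is constant in z, so it can be evaluated at a zero of F_v, where
it equals F_w ≥ 0. -/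
theorem zsmul_monomial_le {Ω : Set Plane} (hc : IsCompact Ω) (hne : Ω.Nonempty) {v w : Lattice} {k : ℤ}
    (hw : w = k • v) (z : Plane) : k * monomial Ω v z ≤ monomial Ω w z := by
  obtain ⟨x, hx, hx0⟩ := exists_monomial_eq_zero hc hne v
  have h : 0 ≤ monomial Ω w x := monomial_nonneg hc hx w
  subst hw
  simp only [monomial_eq, Pi.smul_apply, smul_eq_mul, Int.cast_mul] at *
  have hx1 : (k : ℝ) * (coeff Ω v + (v 0 * x 0 + v 1 * x 1)) = 0 := by rw [hx0, mul_zero]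
  nlinarith

/-- A monomial that is active at a point of the positive superlevel set has primitive slope. -/
theorem isPrimitive_of_monomial_eq {Ω : Set Plane} (hc : IsCompact Ω) {ε : ℝ} (hε : 0 < ε)
    {z : Plane} (hz : z ∈ superlevelSet Ω ε) {v : Lattice} (hv : v ≠ 0)
    (h : monomial Ω v z = ε) : IsPrimitive v := by
  set g : ℤ := (Int.gcd (v 0) (v 1) : ℤ) with hg
  obtain ⟨a, ha⟩ : g ∣ v 0 := Int.gcd_dvd_left ..
  obtain ⟨b, hb⟩ : g ∣ v 1 := Int.gcd_dvd_right ..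
  have hvg : v = g • ![a, b] := by
    ext i; fin_cases i
    · simpa using ha
    · simpa using hb
  have hu : (![a, b] : Lattice) ≠ 0 := fun h0 => hv (by rw [hvg, h0, smul_zero])
  have hle := zsmul_monomial_le hc ⟨z, hz.1⟩ hvg z
  have hεu := ((mem_superlevelSet_iff hc).1 hz).2 _ hu
  have hg0 : g ≠ 0 := fun h0 => hv (by rw [hvg, h0, zero_smul])
  have hg1 : g = 1 := by
    have hgpos : 0 < g := lt_of_le_of_ne (Int.natCast_nonneg _) hg0.symm
    -- For g ≥ 2, F_v(z) ≥ g F_{v/g}(z) ≥ g ε > ε.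
    by_contra hne
    have h2 : (2 : ℝ) ≤ (g : ℝ) := by exact_mod_cast (show (2 : ℤ) ≤ g by omega)
    rw [h] at hle
    nlinarith
  rw [IsPrimitive, Int.isCoprime_iff_gcd_eq_one]
  exact Int.natCast_inj.1 (hg.symm.trans hg1)

theorem mem_frontier_of_monomial_eq_zero {Ω : Set Plane} (hc : IsCompact Ω) {v : Lattice}
    (hv : v ≠ 0) {x : Plane} (hx : x ∈ Ω) (h : monomial Ω v x = 0) : x ∈ frontier Ω :=
  ⟨subset_closure hx, notMem_interior_of_isMin (Ω := Ω) hv fun _ hy =>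
    h.trans_le (monomial_nonneg hc hy v)⟩

theorem isSupportingNormal_of_monomial_eq_zero {Ω : Set Plane} (hc : IsCompact Ω) {v : Lattice}
    (hv : v ≠ 0) {x : Plane} (hx : x ∈ Ω) (h : monomial Ω v x = 0) :
    IsSupportingNormal Ω x (-toPlane v) := by
  refine ⟨fun h0 => hv ?_, hx, fun z hz => ?_⟩
  · ext i
    have := congrFun h0 i
    simpa [toPlane] using this
  · have := monomial_nonneg hc hz v
    rw [monomial] at h
    rw [neg_dotProduct, neg_dotProduct]
    linarith

/-- Without corners, two independent monomials never vanish at the same point of `Ω`. -/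
theorem det_eq_zero_of_monomial_eq_zero {Ω : Set Plane} (hc : IsCompact Ω) (hcorner : NoCorners Ω)
    {v w : Lattice} {x : Plane} (hx : x ∈ Ω) (hv : monomial Ω v x = 0)
    (hw : monomial Ω w x = 0) : v 0 * w 1 - v 1 * w 0 = 0 := by
  by_contra hd
  have hv0 : v ≠ 0 := by rintro rfl; simp at hd
  have hw0 : w ≠ 0 := by rintro rfl; simp at hd
  refine hcorner x (mem_frontier_of_monomial_eq_zero hc hv0 hx hv)
    ⟨_, _, isSupportingNormal_of_monomial_eq_zero hc hv0 hx hv,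
      isSupportingNormal_of_monomial_eq_zero hc hw0 hx hw, ?_⟩
  rw [LinearIndependent.pair_iff]
  intro s t hst
  have h0 := congrFun hst 0
  have h1 := congrFun hst 1
  simp only [Pi.add_apply, Pi.smul_apply, Pi.neg_apply, toPlane, smul_eq_mul, Pi.zero_apply]
    at h0 h1
  have hd' : (v 0 * w 1 - v 1 * w 0 : ℝ) ≠ 0 := by exact_mod_cast hd
  constructor
  · refine (mul_eq_zero.1 (?_ : s * (v 0 * w 1 - v 1 * w 0 : ℝ) = 0)).resolve_right hd'
    linear_combination (-(w 1 : ℝ)) * h0 + (w 0 : ℝ) * h1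
  · refine (mul_eq_zero.1 (?_ : t * (v 0 * w 1 - v 1 * w 0 : ℝ) = 0)).resolve_right hd'
    linear_combination (v 1 : ℝ) * h0 - (v 0 : ℝ) * h1

/-- A primitive vector `v` and a vector `w` with positive determinant `d`: some lattice point of
the triangle with vertices `0`, `v`, `w` has height `1` over `v`. -/
theorem exists_lattice_point {v w : Lattice} (hv : IsPrimitive v)
    (hd : 0 < v 0 * w 1 - v 1 * w 0) :
    ∃ u : Lattice, ∃ m : ℤ, u ≠ 0 ∧ 0 ≤ m ∧ m < v 0 * w 1 - v 1 * w 0 ∧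
      (v 0 * w 1 - v 1 * w 0) * u 0 = m * v 0 + w 0 ∧
      (v 0 * w 1 - v 1 * w 0) * u 1 = m * v 1 + w 1 := by
  obtain ⟨x, y, hxy⟩ := hv
  -- The vector (-y, x) has determinant 1 with v, and d (-y, x) = e v + w. Subtracting (e / d) v
  -- reduces the coefficient e modulo d.
  set d := v 0 * w 1 - v 1 * w 0 with hd'
  set e := -y * w 1 - x * w 0 with he
  have hmod : e % d = e - d * (e / d) := Int.emod_def e d
  refine ⟨![-y - e / d * v 0, x - e / d * v 1], e % d, fun h => ?_, Int.emod_nonneg _ hd.ne',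
    Int.emod_lt_of_pos _ hd, ?_, ?_⟩
  · have h0 := congrFun h 0
    have h1 := congrFun h 1
    simp only [Matrix.cons_val_zero, Matrix.cons_val_one, Pi.zero_apply] at h0 h1
    have : (1 : ℤ) = 0 := by linear_combination v 0 * h1 - v 1 * h0 - hxy
    exact one_ne_zero this
  · simp only [Matrix.cons_val_zero]
    rw [hmod, he, hd']
    linear_combination w 0 * hxy
  · simp only [Matrix.cons_val_one, Matrix.cons_val_zero]
    rw [hmod, he, hd']
    linear_combination w 1 * hxy

theorem det_eq_one_of_pos {Ω : Set Plane} (hc : IsCompact Ω) (hcorner : NoCorners Ω)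
    {ε : ℝ} (hε : 0 < ε) {p : Plane} (hp : p ∈ superlevelSet Ω ε) {v w : Lattice}
    (hv : monomial Ω v p = ε) (hw : monomial Ω w p = ε) (hd : 0 < v 0 * w 1 - v 1 * w 0) :
    v 0 * w 1 - v 1 * w 0 = 1 := by
  have hv0 : v ≠ 0 := by rintro rfl; simp at hd
  obtain ⟨u, m, hu, hm0, hmd, h0, h1⟩ :=
    exists_lattice_point (isPrimitive_of_monomial_eq hc hε hp hv0 hv) hd
  obtain ⟨x, hx, hxu⟩ := exists_monomial_eq_zero hc ⟨p, hp.1⟩ u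
  have hvx : 0 ≤ monomial Ω v x := monomial_nonneg hc hx v
  have hwx : 0 ≤ monomial Ω w x := monomial_nonneg hc hx w
  have hup := ((mem_superlevelSet_iff hc).1 hp).2 u hu
  have hdet := fun h h' =>
    hd.ne' (det_eq_zero_of_monomial_eq_zero (v := v) (w := w) hc hcorner hx h h')
  set d := v 0 * w 1 - v 1 * w 0
  have h0' : (d : ℝ) * u 0 = m * v 0 + w 0 := by exact_mod_cast h0
  have h1' : (d : ℝ) * u 1 = m * v 1 + w 1 := by exact_mod_cast h1
  have hmR : (0 : ℝ) ≤ m := by exact_mod_cast hm0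
  have hdR : (0 : ℝ) < d := by exact_mod_cast hd
  have hmdR : (m : ℝ) + 1 ≤ d := by exact_mod_cast hmd
  have key : (d : ℝ) * monomial Ω u p =
      (m + 1) * ε - (m * monomial Ω v x + monomial Ω w x) := by
    have e1 : monomial Ω u p = monomial Ω u p - monomial Ω u x := by rw [hxu, sub_zero]
    have e2 : (m + 1) * ε = m * monomial Ω v p + monomial Ω w p := by rw [hv, hw]; ring
    rw [e1, e2]
    simp only [monomial_eq]
    linear_combination (p 0 - x 0) * h0' + (p 1 - x 1) * h1'
  have hge : (d : ℝ) * ε ≤ d * monomial Ω u p := mul_le_mul_of_nonneg_left hup hdR.le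
  have hmv : 0 ≤ m * monomial Ω v x := mul_nonneg hmR hvx
  have hmε : (m + 1) * ε ≤ d * ε := mul_le_mul_of_nonneg_right hmdR hε.le
  have hwx0 : monomial Ω w x = 0 := by linarith
  have hmv0 : m * monomial Ω v x = 0 := by linarith
  -- Equality forces d = m + 1, so m = 0 gives d = 1; otherwise F_v and F_w both vanish at x.
  rcases mul_eq_zero.1 hmv0 with hm | hvx0
  · have hm' : (d : ℝ) * ε ≤ ε := by rw [hm] at hmε key; linarith
    have : (d : ℝ) ≤ 1 := by
      by_contra! hlt
      nlinarith
    have : d ≤ 1 := by exact_mod_cast this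
    omega
  · exact (hdet hvx0 hwx0).elim

theorem isUnit_det_of_monomial_eq {Ω : Set Plane} (hc : IsCompact Ω) (hcorner : NoCorners Ω)
    {ε : ℝ} (hε : 0 < ε) {p : Plane} (hp : p ∈ superlevelSet Ω ε) {v w : Lattice}
    (hv : monomial Ω v p = ε) (hw : monomial Ω w p = ε) (hd : v 0 * w 1 - v 1 * w 0 ≠ 0) :
    IsUnit (v 0 * w 1 - v 1 * w 0) := by
  rw [Int.isUnit_iff]
  rcases lt_or_gt_of_ne hd with h | h
  · have := det_eq_one_of_pos hc hcorner hε hp hw hv (by linarith)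
    right
    linarith
  · exact Or.inl (det_eq_one_of_pos hc hcorner hε hp hv hw h)

/-! ### Sides and lattice bases -/

/-- Sides of the superlevel set are the loci where a monomial is active. -/
theorem exists_monomial_of_isSide {Ω : Set Plane} (hΩ : IsCompactConvexDomain Ω)
    {ε : ℝ} (hε : 0 < ε) {S : Set Plane} (hS : IsSide (superlevelSet Ω ε) S) :
    ∃ v : Lattice, v ≠ 0 ∧ IsPrimitive v ∧ S = {z ∈ superlevelSet Ω ε | monomial Ω v z = ε} := by
  obtain ⟨hexp, hSΔ, p, hp, q, hq, hpq⟩ := hS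
  obtain ⟨l, hl⟩ := hexp ⟨p, hp⟩
  rw [hl] at hp hq
  have hmem := fun {y} => mem_superlevelSet_iff (z := y) (ε := ε) hΩ.isCompact
  have hlpq : l p = l q := le_antisymm (hq.2 p hp.1) (hp.2 q hq.1)
  set a := l ![1, 0]
  set b := l ![0, 1]
  have hlz : ∀ z : Plane, l z = z 0 * a + z 1 * b := dual_apply l
  -- The midpoint is a boundary point, so some F_v equals ε there; as F_v ≥ ε at p and q, it equals
  -- ε at both.
  set c : Plane := (1 / 2 : ℝ) • p + (1 / 2 : ℝ) • q with hcdef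
  have hmonc : ∀ v : Lattice, monomial Ω v c = (monomial Ω v p + monomial Ω v q) / 2 := by
    intro v
    simp only [monomial_eq, hcdef, Pi.add_apply, Pi.smul_apply, smul_eq_mul]
    ring
  have hcΔ : c ∈ superlevelSet Ω ε := by
    refine hmem.2 ⟨hΩ.convex hp.1.1 hq.1.1 (by norm_num) (by norm_num) (by norm_num), ?_⟩
    intro v hv
    have h1 := (hmem.1 hp.1).2 v hv
    have h2 := (hmem.1 hq.1).2 v hv
    rw [hmonc]
    linarith
  have hlc : l c = l p := by
    simp only [hcdef, map_add, map_smul, smul_eq_mul, hlpq]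
    ring
  have hab : a ≠ 0 ∨ b ≠ 0 := by
    by_contra! h
    refine hSΔ ?_
    rw [hl]
    ext z
    simp [hlz, h.1, h.2]
  have hci : c ∉ interior (superlevelSet Ω ε) := by
    intro hci
    have hcont : Continuous fun t : ℝ => c + t • (![a, b] : Plane) := by fun_prop
    have hev : ∀ᶠ t in nhds (0 : ℝ), c + t • (![a, b] : Plane) ∈ superlevelSet Ω ε :=
      hcont.continuousAt.eventually_mem (by simpa using mem_interior_iff_mem_nhds.1 hci)
    obtain ⟨t, ht, ht0⟩ := ((hev.filter_mono nhdsWithin_le_nhds).and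
      (self_mem_nhdsWithin (s := Ioi (0 : ℝ)))).exists
    have ht0 : 0 < t := ht0
    have h := hp.2 _ ht
    rw [map_add, hlc, map_smul, hlz ![a, b]] at h
    simp only [Matrix.cons_val_zero, Matrix.cons_val_one, smul_eq_mul] at h
    have hpos : 0 < a * a + b * b := by
      rcases hab with h | h
      · nlinarith [mul_self_pos.2 h, mul_self_nonneg b]
      · nlinarith [mul_self_pos.2 h, mul_self_nonneg a]
    nlinarith [mul_pos ht0 hpos]
  rw [mem_interior_superlevelSet_iff hΩ hε hcΔ] at hci
  push Not at hci
  obtain ⟨v, hv, hvc⟩ := hci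
  have h1 := (hmem.1 hp.1).2 v hv
  have h2 := (hmem.1 hq.1).2 v hv
  have hvp : monomial Ω v p = ε := by rw [hmonc] at hvc; linarith
  have hvq : monomial Ω v q = ε := by rw [hmonc] at hvc; linarith
  refine ⟨v, hv, isPrimitive_of_monomial_eq hΩ.isCompact hε hp.1 hv hvp, ?_⟩
  have hv2 : ¬ ((v 0 : ℝ) = 0 ∧ (v 1 : ℝ) = 0) := by
    rintro ⟨h0, h1⟩
    refine hv ?_
    ext i; fin_cases i
    · exact_mod_cast h0
    · exact_mod_cast h1
  have hdv : (v 0 : ℝ) * (q 0 - p 0) + v 1 * (q 1 - p 1) = 0 := by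
    rw [monomial_eq] at hvp hvq
    linear_combination hvq - hvp
  have hdl : a * (q 0 - p 0) + b * (q 1 - p 1) = 0 := by
    rw [hlz, hlz] at hlpq
    linear_combination -hlpq
  -- Both l and v annihilate q - p ≠ 0, so they are parallel.
  have hcross : a * v 1 - b * v 0 = 0 := by
    have hq0 : q 0 - p 0 ≠ 0 ∨ q 1 - p 1 ≠ 0 := by
      by_contra! h
      refine hpq ?_
      ext i; fin_cases i
      · exact (sub_eq_zero.1 h.1).symm
      · exact (sub_eq_zero.1 h.2).symm
    rcases hq0 with h | h
    · refine (mul_eq_zero.1 (?_ : (q 0 - p 0) * (a * v 1 - b * v 0) = 0)).resolve_left h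
      linear_combination v 1 * hdl - b * hdv
    · refine (mul_eq_zero.1 (?_ : (q 1 - p 1) * (a * v 1 - b * v 0) = 0)).resolve_left h
      linear_combination a * hdv - v 0 * hdl
  have hnorm : (0 : ℝ) < v 0 ^ 2 + v 1 ^ 2 := by
    by_contra! h
    exact hv2 ⟨by nlinarith [sq_nonneg (v 0 : ℝ), sq_nonneg (v 1 : ℝ)],
      by nlinarith [sq_nonneg (v 0 : ℝ), sq_nonneg (v 1 : ℝ)]⟩
  -- `l` is a multiple of `v`
  obtain ⟨k, hka, hkb⟩ : ∃ k : ℝ, a = k * v 0 ∧ b = k * v 1 := by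
    refine ⟨(a * v 0 + b * v 1) / (v 0 ^ 2 + v 1 ^ 2), ?_, ?_⟩
    · rw [div_mul_eq_mul_div, eq_div_iff hnorm.ne']
      linear_combination v 1 * hcross
    · rw [div_mul_eq_mul_div, eq_div_iff hnorm.ne']
      linear_combination -v 0 * hcross
  have hlk : ∀ z : Plane, l z - l p = k * (monomial Ω v z - ε) := by
    intro z
    rw [← hvp, hlz, hlz, monomial_eq, monomial_eq, hka, hkb]
    ring
  have hk0 : k ≠ 0 := by
    rintro rfl
    simp [hka, hkb] at hab
  ext z
  constructor
  · intro hz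
    rw [hl] at hz
    refine ⟨hz.1, ?_⟩
    have := hlk z
    rw [le_antisymm (hp.2 z hz.1) (hz.2 p hp.1), sub_self] at this
    have := (mul_eq_zero.1 this.symm).resolve_left hk0
    linarith
  · rintro ⟨hz, hzε⟩
    rw [hl]
    refine ⟨hz, fun y hy => ?_⟩
    have := hlk z
    rw [hzε, sub_self, mul_zero] at this
    have := hp.2 y hy
    linarith

theorem orthogonal_of_isPrimitiveDirection {Ω S : Set Plane} {ε : ℝ} {u v : Lattice}
    (hS : S.Nontrivial) (hSv : ∀ z ∈ S, monomial Ω v z = ε) (hu : IsPrimitiveDirection S u) :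
    v 0 * u 0 + v 1 * u 1 = 0 := by
  obtain ⟨p, hp, q, hq, hpq⟩ := hS
  obtain ⟨t, ht⟩ := hu.2 p hp q hq
  have ht0 : t ≠ 0 := by
    rintro rfl
    rw [zero_smul, sub_eq_zero] at ht
    exact hpq ht.symm
  have h0 : q 0 - p 0 = t * u 0 := congrFun ht 0
  have h1 : q 1 - p 1 = t * u 1 := congrFun ht 1
  have hp' := hSv p hp
  have hq' := hSv q hq
  rw [monomial_eq] at hp' hq'
  have : t * (v 0 * u 0 + v 1 * u 1 : ℝ) = 0 := by
    linear_combination hq' - hp' - v 0 * h0 - v 1 * h1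
  exact_mod_cast (mul_eq_zero.1 this).resolve_left ht0

/-- A Bézout relation for v writes u as c times the rotated v; c divides both coordinates of the
primitive u, hence is a unit. -/
theorem exists_isUnit_of_orthogonal {u v : Lattice} (hu : IsPrimitive u) (hv : IsPrimitive v)
    (h : v 0 * u 0 + v 1 * u 1 = 0) :
    ∃ c : ℤ, IsUnit c ∧ u 0 = - c * v 1 ∧ u 1 = c * v 0 := by
  obtain ⟨x, y, hxy⟩ := hv
  have h0 : u 0 = - (x * u 1 - y * u 0) * v 1 := by linear_combination x * h - u 0 * hxy
  have h1 : u 1 = (x * u 1 - y * u 0) * v 0 := by linear_combination y * h - u 1 * hxy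
  refine ⟨x * u 1 - y * u 0, ?_, h0, h1⟩
  exact hu.isUnit_of_dvd' ⟨-v 1, by linear_combination h0⟩ ⟨v 0, h1⟩

theorem exists_basis_of_isUnit_det {u w : Lattice} (h : IsUnit (u 0 * w 1 - u 1 * w 0)) :
    ∃ b : Module.Basis (Fin 2) ℤ Lattice, ⇑b = ![u, w] := by
  have hdet : IsUnit ((Pi.basisFun ℤ (Fin 2)).det ![u, w]) := by
    rw [Pi.basisFun_det_apply, Matrix.det_fin_two]
    convert h using 1
    simp
  obtain ⟨hli, hsp⟩ := (Module.Basis.is_basis_iff_det _).2 hdet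
  exact ⟨Module.Basis.mk hli hsp.ge, Module.Basis.coe_mk _ _⟩

theorem isPrimitiveDirection_rotate {Ω A : Set Plane} {ε : ℝ} {v : Lattice} (hv : IsPrimitive v) :
    IsPrimitiveDirection {z ∈ A | monomial Ω v z = ε} ![-v 1, v 0] := by
  refine ⟨by simpa [IsPrimitive] using hv.symm.neg_left, fun p hp q hq => ?_⟩
  obtain ⟨x, y, hxy⟩ := hv
  have hxy' : (x * v 0 + y * v 1 : ℝ) = 1 := by exact_mod_cast hxy
  have hpq : (v 0 * (q 0 - p 0) + v 1 * (q 1 - p 1) : ℝ) = 0 := by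
    have h1 := hp.2
    have h2 := hq.2
    rw [monomial_eq] at h1 h2
    linear_combination h2 - h1
  refine ⟨x * (q 1 - p 1) - y * (q 0 - p 0), ?_⟩
  ext i
  fin_cases i
  · simp only [Fin.zero_eta, Pi.sub_apply, Pi.smul_apply, toPlane, smul_eq_mul,
      Matrix.cons_val_zero, Int.cast_neg]
    linear_combination x * hpq - (q 0 - p 0) * hxy'
  · simp only [Fin.mk_one, Pi.sub_apply, Pi.smul_apply, toPlane, smul_eq_mul,
      Matrix.cons_val_one, Matrix.cons_val_fin_one]
    linear_combination y * hpq - (q 1 - p 1) * hxy'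

/-- Monomials cutting out two different sides with a common point are independent. -/
theorem det_ne_zero_of_sides {Ω : Set Plane} (hΩ : IsCompactConvexDomain Ω) {ε : ℝ} (hε : 0 < ε)
    (hint : (interior (superlevelSet Ω ε)).Nonempty) {v w : Lattice}
    (hv : IsPrimitive v) (hw : IsPrimitive w) (hv0 : v ≠ 0) (hw0 : w ≠ 0) {p : Plane}
    (hvp : monomial Ω v p = ε) (hwp : monomial Ω w p = ε)
    (hne : {z ∈ superlevelSet Ω ε | monomial Ω v z = ε} ≠
      {z ∈ superlevelSet Ω ε | monomial Ω w z = ε}) :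
    v 0 * w 1 - v 1 * w 0 ≠ 0 := by
  intro hd
  obtain ⟨c, hc, hc0, hc1⟩ := exists_isUnit_of_orthogonal (u := ![-w 1, w 0]) (v := v)
    (by simpa [IsPrimitive] using hw.symm.neg_left) hv
    (by simp only [Matrix.cons_val_zero, Matrix.cons_val_one]; linear_combination -hd)
  simp only [Matrix.cons_val_zero, Matrix.cons_val_one] at hc0 hc1
  rcases Int.isUnit_iff.1 hc with rfl | rfl
  · refine hne ?_
    have : v = w := by ext i; fin_cases i <;> simp <;> linarith
    rw [this]
  -- Here w = -v, so F_v + F_w is constant and equal to 2ε; both terms are at least ε, hence F_v = ε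
  -- at an interior point, which is impossible.
  · obtain ⟨z, hz⟩ := hint
    have hzΔ := interior_subset hz
    have h1 := ((mem_superlevelSet_iff hΩ.isCompact).1 hzΔ).2 v hv0
    have h2 := ((mem_superlevelSet_iff hΩ.isCompact).1 hzΔ).2 w hw0
    have hw0' : (w 0 : ℝ) = - v 0 := by exact_mod_cast (show w 0 = - v 0 by linarith)
    have hw1' : (w 1 : ℝ) = - v 1 := by exact_mod_cast (show w 1 = - v 1 by linarith)
    refine (mem_interior_superlevelSet_iff hΩ hε hzΔ).1 hz v hv0 ?_
    rw [monomial_eq] at *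
    rw [hw0', hw1'] at hwp h2
    linarith

theorem isDelzant_superlevelSet {Ω : Set Plane} (hΩ : IsCompactConvexDomain Ω)
    (hcorner : NoCorners Ω) {ε : ℝ} (hε : 0 < ε) (hεm : ε < maxValue Ω) :
    IsDelzant (superlevelSet Ω ε) := by
  have hpoly := isConvexPolygon_superlevelSet hΩ hε hεm
  refine ⟨⟨hpoly, fun S hS => ?_⟩, ?_⟩
  · obtain ⟨v, -, hv, rfl⟩ := exists_monomial_of_isSide hΩ hε hS
    exact ⟨_, isPrimitiveDirection_rotate hv⟩
  · rintro S T hS hT hST ⟨p, hpS, hpT⟩ u u' hu hu'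
    obtain ⟨v, hv0, hv, rfl⟩ := exists_monomial_of_isSide hΩ hε hS
    obtain ⟨w, hw0, hw, rfl⟩ := exists_monomial_of_isSide hΩ hε hT
    have hdet := isUnit_det_of_monomial_eq hΩ.isCompact hcorner hε hpS.1 hpS.2 hpT.2
      (det_ne_zero_of_sides hΩ hε hpoly.2.1 hv hw hv0 hw0 hpS.2 hpT.2 hST)
    obtain ⟨c, hc, hc0, hc1⟩ := exists_isUnit_of_orthogonal hu.1 hv
      (orthogonal_of_isPrimitiveDirection hS.2.2 (fun z hz => hz.2) hu)
    obtain ⟨c', hc', hc0', hc1'⟩ := exists_isUnit_of_orthogonal hu'.1 hw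
      (orthogonal_of_isPrimitiveDirection hT.2.2 (fun z hz => hz.2) hu')
    apply exists_basis_of_isUnit_det
    -- Rotation preserves determinants, so det(u, u') = c c' det(v, w).
    convert (hc.mul hc').mul hdet using 1
    rw [hc0, hc1, hc0', hc1']
    ring

end TropicalSeries

theorem mainTheorem8 (Ω : Set TropicalSeries.Plane)
    (hΩ : TropicalSeries.IsCompactConvexDomain Ω) (hcorner : TropicalSeries.NoCorners Ω)
    (ε : ℝ) (hε : 0 < ε) (hεm : ε < TropicalSeries.maxValue Ω) :
    TropicalSeries.IsDelzant (TropicalSeries.superlevelSet Ω ε) ∧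
      frontier (TropicalSeries.superlevelSet Ω ε) = TropicalSeries.levelSet Ω ε :=
  ⟨TropicalSeries.isDelzant_superlevelSet hΩ hcorner hε hεm,
    TropicalSeries.frontier_superlevelSet hΩ hε⟩
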